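/- Let $m,n\ge 0$. For a commutative ring $R$, an $m\times n$ matrix $X$ over $R$, and sets $A\subseteq\{1,\dots,m\}$, $B\subseteq\{1,\dots,n\}$, let $(A|B)=X(A|B)$ denote the minor determinant of $X$ with row indices in $A$ and column indices in $B$ (taken in increasing order), with $(A|B)=0$ if $|A|\ne|B|$ and $(\emptyset|\emptyset)=1$. For sets of integers $S=\{s_1<\cdots<s_p\}$ and $T=\{t_1<\cdots<t_q\}$ write $S\le T$ if $p\ge q$ and $s_\nu\le t_\nu$ for all $\nu\le q$; this is a partial order. Order pairs of sets componentwise: $(S,T)\le(U,V)$ if $S\le U$ and $T\le V$; and $(S,T)<(U,V)$ if moreover $(S,T)\ne(U,V)$. **Theorem (straightening law for minors).** Let $S',S''\subseteq\{1,\dots,m\}$ and $T',T''\subseteq\{1,\dots,n\}$ with $(S',T')\nleq(S'',T'')$. Then there are a finite number $N\ge 0$, signs $\varepsilon_i\in\{1,-1\}$, and sets $S'_i,S''_i\subseteq\{1,\dots,m\}$ and $T'_i,T''_i\subseteq\{1,\dots,n\}$ for $1\le i\le N$ (repetitions allowed), depending only on $m,n,S',S'',T',T''$, such that $$(S'_i,T'_i)<(S',T')\quad\text{and}\quad(S'_i,T'_i)\le(S''_i,T''_i)\qquad\text{for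 all } i,$$ and such that for every commutative ring $R$ and every $m\times n$ matrix $X$ over $R$, $$(S'|T')(S''|T'')=\sum_{i=1}^{N}\varepsilon_i\,(S'_i|T'_i)(S''_i|T''_i).$$ -/

import Mathlib

/-- The minor `X(A|B)`: the determinant of the submatrix of `X` with rows in `A` and columns in `B`,
both taken in increasing order; it is `0` if `A` and `B` have different numbers of elements. -/
def minor {R : Type*} [CommRing R] {m n : ℕ} (X : Matrix (Fin m) (Fin n) R)
    (A : Finset (Fin m)) (B : Finset (Fin n)) : R :=
  if h : B.card = A.card then
    (X.submatrix (A.orderEmbOfFin rfl) (B.orderEmbOfFin h)).det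
  else 0

/-- For `S = {s₁ < ⋯ < s_p}` and `T = {t₁ < ⋯ < t_q}`, the order `S ≤ T`:
`p ≥ q` and `s_ν ≤ t_ν` for all `ν ≤ q`. -/
def IndexLE {k : ℕ} (S T : Finset (Fin k)) : Prop :=
  ∃ h : T.card ≤ S.card, ∀ ν : Fin T.card,
    S.orderEmbOfFin rfl (Fin.castLE h ν) ≤ T.orderEmbOfFin rfl ν

/-- The componentwise order on pairs (set of row indices, set of column indices). -/
def PairLE {m n : ℕ} (P Q : Finset (Fin m) × Finset (Fin n)) : Prop :=
  IndexLE P.1 Q.1 ∧ IndexLE P.2 Q.2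

/-- The strict order on pairs attached to `PairLE`. -/
def PairLT {m n : ℕ} (P Q : Finset (Fin m) × Finset (Fin n)) : Prop :=
  PairLE P Q ∧ P ≠ Q

/-!
The minors `(A|B)` of an `m × n` matrix `X` with `|A| = |B|` are, up to sign, the maximal minors of
the `m × (n + m)` matrix `[X | 1]`: the minor `(A|B)` uses the columns of `X` with index in `B` and
the unit vectors with index outside `A` (`det_blockCol_eq_minor`). Rank the columns of `X` first, in
increasing order, and after them the unit vectors in decreasing order. Then the order on pairs
`(A, B)` becomes the order on sets of `m` columns: `D ≤ C` if, for every `k`, the set `D` has at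
least as many elements of rank below `k` as `C` has (`pairLE_iff_countBelow_blockRank_le`). So it
suffices to straighten a product `[C][C']` of maximal minors.

If `C ≰ C'`, then for some `k` fewer elements of `C` than of `C'` have rank below `k`. Together, the
elements of `C` of rank at least `k` and those of `C'` of rank below `k` number more than `m`, so
the alternating sum of `[C][C']` over all shuffles of these vectors between the two factors is an
alternating map in more than `m` vectors of `R ^ m`, hence zero
(`det_mul_det_mem_closure_exchange`). Every term other than `[C][C']` has as first factor some
`D < C`, since elements of `C` of rank at least `k` have been replaced by elements of rank below `k`
(`countBelow_lt_of_exchange`). Repeating this for the terms `[D][D']` with `D ≰ D'` terminates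
because there are finitely many `D` (`blockMinor_mul_mem_closure_standard`).

Only the existence of signs is asserted, so the argument takes place in the additive subgroup
generated by the products wanted. Applied to the generic matrix over `ℤ[x_ij]` it gives one formula,
which specializes to every matrix over every commutative ring.
-/

open Matrix Equiv

/-! ### Exchange of vectors between two determinants -/

/-- The alternating map in the variables `i` with `P i`, obtained from `f` by giving the other
variables the fixed values `z`. -/
def AlternatingMap.fixOutside {R M N ι : Type*} [CommRing R] [AddCommGroup M] [Module R M]
    [AddCommGroup N] [Module R N] (f : M [⋀^ι]→ₗ[R] N) (P : ι → Prop) [DecidablePred P]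
    (z : {i // ¬ P i} → M) : M [⋀^{i // P i}]→ₗ[R] N :=
  { f.toMultilinearMap.domDomRestrict P z with
    map_eq_zero_of_eq' := by
      intro v i j hv hij
      refine f.map_eq_zero_of_eq _ (i := i.1) (j := j.1) ?_ (fun h => hij (Subtype.ext h))
      simpa [i.2, j.2] using hv }

theorem AlternatingMap.fixOutside_apply {R M N ι : Type*} [CommRing R] [AddCommGroup M]
    [Module R M] [AddCommGroup N] [Module R N] (f : M [⋀^ι]→ₗ[R] N) (P : ι → Prop)
    [DecidablePred P] (z : {i // ¬ P i} → M) (x : {i // P i} → M) :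
    f.fixOutside P z x = f fun i => if h : P i then x ⟨i, h⟩ else z ⟨i, h⟩ := rfl

theorem AlternatingMap.eq_zero_of_card_lt {R N κ ι : Type*} [CommRing R] [AddCommGroup N]
    [Module R N] [Fintype κ] [Fintype ι] (f : (κ → R) [⋀^ι]→ₗ[R] N)
    (h : Fintype.card κ < Fintype.card ι) : f = 0 :=
  (Pi.basisFun R κ).ext_alternating fun v hv =>
    absurd (Fintype.card_le_of_injective v hv) h.not_ge

/-- A product of two determinants is an integral combination of products in which rows of the
second determinant with property `P` have replaced rows of the first without it, provided that the
first has fewer rows with property `P` than the second. The second factor needs no control. -/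
theorem det_mul_det_mem_closure_exchange {K R : Type*} [CommRing R] {m : ℕ} (w : K → Fin m → R)
    (c c' : Fin m → K) (P : K → Prop) [DecidablePred P]
    (hP : Fintype.card {i // P (c i)} < Fintype.card {i // P (c' i)}) :
    det (of fun i => w (c i)) * det (of fun i => w (c' i)) ∈
      AddSubgroup.closure {x : R | ∃ d d' : Fin m → K,
        (∀ i, P (c i) → d i = c i) ∧ (∀ i, ¬ P (c i) → P (d i) ∨ ∃ j, d i = c j) ∧
        (∃ i, ¬ P (c i) ∧ P (d i)) ∧
        x = det (of fun i => w (d i)) * det (of fun i => w (d' i))} := by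
  classical
  -- `a` and `b` are the two determinants as functions of the rows to be exchanged; `d σ` and `d' σ`
  -- index the rows after these have been rearranged by `σ`.
  let a := (detRowAlternating : (Fin m → R) [⋀^Fin m]→ₗ[R] R).fixOutside
    (fun i => ¬ P (c i)) (fun i => w (c i))
  let b := (detRowAlternating : (Fin m → R) [⋀^Fin m]→ₗ[R] R).fixOutside
    (fun i => P (c' i)) (fun i => w (c' i))
  let v : {i // ¬ P (c i)} ⊕ {i // P (c' i)} → K := Sum.elim (fun i => c i) (fun i => c' i)
  have h0 : a.domCoprod b = 0 := by
    apply AlternatingMap.eq_zero_of_card_lt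
    have := Fintype.card_subtype_compl (fun i => P (c i))
    have h2 := Fintype.card_subtype_le (fun i => P (c i))
    rw [Fintype.card_sum]
    omega
  let d (σ : Perm ({i // ¬ P (c i)} ⊕ {i // P (c' i)})) (i : Fin m) : K :=
    if h : ¬ P (c i) then v (σ (Sum.inl ⟨i, h⟩)) else c i
  let d' (σ : Perm ({i // ¬ P (c i)} ⊕ {i // P (c' i)})) (i : Fin m) : K :=
    if h : P (c' i) then v (σ (Sum.inr ⟨i, h⟩)) else c' i
  have hterm (σ : Perm ({i // ¬ P (c i)} ⊕ {i // P (c' i)})) :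
      LinearMap.mul' R R (AlternatingMap.domCoprod.summand a b (Quotient.mk'' σ) (w ∘ v)) =
        Perm.sign σ • (det (of fun i => w (d σ i)) * det (of fun i => w (d' σ i))) := by
    rw [AlternatingMap.domCoprod.summand_mk'']
    have ha : a (fun i => w (v (σ (Sum.inl i)))) = det (of fun i => w (d σ i)) := by
      rw [AlternatingMap.fixOutside_apply]
      change det _ = _
      congr 1
      ext i j
      by_cases h : P (c i) <;> simp [d, h]
    have hb : b (fun i => w (v (σ (Sum.inr i)))) = det (of fun i => w (d' σ i)) := by
      rw [AlternatingMap.fixOutside_apply]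
      change det _ = _
      congr 1
      ext i j
      by_cases h : P (c' i) <;> simp [d', h]
    rw [← ha, ← hb]
    rw [_root_.smul_apply, Units.smul_def, map_zsmul, Units.smul_def]
    rfl
  have hsum : ∑ σ : Perm.ModSumCongr {i // ¬ P (c i)} {i // P (c' i)},
      LinearMap.mul' R R (AlternatingMap.domCoprod.summand a b σ (w ∘ v)) = 0 := by
    have := congrArg (fun f => LinearMap.mul' R R (f (w ∘ v))) h0
    simpa [AlternatingMap.domCoprod_apply, _root_.sum_apply] using this
  replace hsum := (Finset.add_sum_erase _ _ (Finset.mem_univ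
    (Quotient.mk'' 1 : Perm.ModSumCongr {i // ¬ P (c i)} {i // P (c' i)}))).trans hsum
  have h1 := hterm 1
  have hd : d 1 = c := by
    ext i; by_cases h : P (c i) <;> simp [d, h, v]
  have hd' : d' 1 = c' := by
    ext i; by_cases h : P (c' i) <;> simp [d', h, v]
  rw [hd, hd', Perm.sign_one, one_smul] at h1
  rw [h1] at hsum
  rw [eq_neg_of_add_eq_zero_left hsum]
  -- The class of `1` gives the original product. In any other class some row really moves from
  -- the second determinant to the first.
  refine neg_mem (sum_mem fun σ hσ => ?_)
  induction σ using Quotient.inductionOn' with | _ σ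
  rw [hterm, Units.smul_def]
  refine zsmul_mem ?_ _
  refine AddSubgroup.subset_closure ⟨d σ, d' σ, ?_, ?_, ?_, rfl⟩
  · intro i hi
    simp [d, hi]
  · intro i hi
    simp only [d, hi, not_false_eq_true, dite_true]
    rcases σ (Sum.inl ⟨i, hi⟩) with j | j
    · exact Or.inr ⟨j, rfl⟩
    · exact Or.inl j.2
  · by_contra! hcon
    refine (Finset.mem_erase.mp hσ).1 (Quotient.sound' ?_)
    rw [QuotientGroup.leftRel_apply, mul_one, inv_mem_iff]
    refine Perm.mem_sumCongrHom_range_of_perm_mapsTo_inl ?_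
    rintro _ ⟨i, rfl⟩
    have h := hcon i i.2
    simp only [d, i.2, not_false_eq_true, dite_true] at h
    rcases hs : σ (Sum.inl i) with j | j
    · exact ⟨j, rfl⟩
    · rw [show σ (Sum.inl ⟨i.1, i.2⟩) = _ from hs] at h
      exact absurd j.2 h

/-! ### Counting elements of small rank -/

/-- The number of elements of `S` whose rank is less than `k`. -/
def countBelow {α : Type*} (r : α → ℕ) (S : Finset α) (k : ℕ) : ℕ :=
  (S.filter fun x => r x < k).card

theorem countBelow_eq_card_fin {k : ℕ} (S : Finset (Fin k)) (j : ℕ) :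
    countBelow Fin.val S j =
      (Finset.univ.filter fun ν : Fin S.card => (S.orderEmbOfFin rfl ν : ℕ) < j).card := by
  rw [countBelow, ← Finset.card_map (S.orderEmbOfFin rfl).toEmbedding]
  congr 1
  ext x
  simp only [Finset.mem_filter, Finset.mem_map, Finset.mem_univ, true_and]
  constructor
  · rintro ⟨hx, hj⟩
    have : x ∈ Set.range (S.orderEmbOfFin rfl) := by simpa using hx
    obtain ⟨ν, rfl⟩ := this
    exact ⟨ν, hj, rfl⟩
  · rintro ⟨ν, hj, rfl⟩
    exact ⟨S.orderEmbOfFin_mem rfl ν, hj⟩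

/-- `S ≤ T` exactly when every initial segment contains at least as many elements of `S` as of
`T`. -/
theorem indexLE_iff_countBelow_le {k : ℕ} {S T : Finset (Fin k)} :
    IndexLE S T ↔ countBelow Fin.val T ≤ countBelow Fin.val S := by
  constructor
  · rintro ⟨h, hle⟩ j
    rw [countBelow_eq_card_fin, countBelow_eq_card_fin]
    refine Finset.card_le_card_of_injOn (Fin.castLE h) (fun ν hν => ?_)
      (Fin.castLE_injective h).injOn
    simp only [Finset.coe_filter, Finset.mem_univ, true_and, Set.mem_ofPred_eq] at hν ⊢
    exact lt_of_le_of_lt (hle ν) hν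
  · intro hle
    have hcard (U : Finset (Fin k)) : countBelow Fin.val U k = U.card := by
      rw [countBelow, Finset.filter_true_of_mem fun x _ => x.2]
    have h : T.card ≤ S.card := by simpa only [hcard] using hle k
    refine ⟨h, fun ν => ?_⟩
    by_contra! hlt
    have hν : countBelow Fin.val T (T.orderEmbOfFin rfl ν + 1) ≤
        countBelow Fin.val S (T.orderEmbOfFin rfl ν + 1) := hle _
    rw [countBelow_eq_card_fin, countBelow_eq_card_fin] at hν
    have h1 : ν.1 + 1 ≤ (Finset.univ.filter fun μ : Fin T.card =>
        (T.orderEmbOfFin rfl μ : ℕ) < T.orderEmbOfFin rfl ν + 1).card := by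
      rw [← Fin.card_Iic]
      refine Finset.card_le_card fun μ hμ => ?_
      simpa [Nat.lt_succ_iff] using hμ
    have h2 : (Finset.univ.filter fun μ : Fin S.card =>
        (S.orderEmbOfFin rfl μ : ℕ) < T.orderEmbOfFin rfl ν + 1).card ≤ ν.1 := by
      have := Fin.card_Iio (Fin.castLE h ν)
      rw [Fin.val_castLE] at this
      rw [← this]
      refine Finset.card_le_card fun μ hμ => ?_
      simp only [Finset.mem_filter, Finset.mem_univ, true_and, Nat.lt_succ_iff,
        Fin.val_fin_le] at hμ
      simpa using hμ.trans_lt hlt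
    omega

/-! ### Minors of a matrix as maximal minors of a block matrix -/

section Encoding

variable {m n : ℕ}

/-- The rank of a column of `[X | 1]`: the columns of `X` come first, in order, followed by the
columns of the identity matrix in reverse order. -/
def blockRank : Fin n ⊕ Fin m → ℕ :=
  Sum.elim (fun j => j) (fun i => n + (m - 1 - i))

@[simp] theorem blockRank_inl (j : Fin n) :
    blockRank (Sum.inl j : Fin n ⊕ Fin m) = j := rfl

@[simp] theorem blockRank_inr (i : Fin m) :
    blockRank (Sum.inr i : Fin n ⊕ Fin m) = n + (m - 1 - i) := rfl

/-- The columns of the block matrix `[X | 1]`. -/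
def blockCol {R : Type*} [CommRing R] (X : Matrix (Fin m) (Fin n) R) :
    Fin n ⊕ Fin m → Fin m → R :=
  Sum.elim (fun j i => X i j) (fun i => Pi.single i 1)

/-- The row indices of the minor of `X` that corresponds to a set of columns of `[X | 1]`: the
rows whose unit vector is not in the set. -/
def rowPart (C : Finset (Fin n ⊕ Fin m)) : Finset (Fin m) :=
  Finset.univ.filter fun i => Sum.inr i ∉ C

/-- The column indices of the minor of `X` that corresponds to a set of columns of `[X | 1]`. -/
def colPart (C : Finset (Fin n ⊕ Fin m)) : Finset (Fin n) :=
  Finset.univ.filter fun j => Sum.inl j ∈ C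

/-- The set of columns of `[X | 1]` that corresponds to the minor `X(A|B)`. -/
def blockSet (A : Finset (Fin m)) (B : Finset (Fin n)) : Finset (Fin n ⊕ Fin m) :=
  B.disjSum Aᶜ

@[simp] theorem mem_rowPart {C : Finset (Fin n ⊕ Fin m)} {i : Fin m} :
    i ∈ rowPart C ↔ Sum.inr i ∉ C := by simp [rowPart]

@[simp] theorem mem_colPart {C : Finset (Fin n ⊕ Fin m)} {j : Fin n} :
    j ∈ colPart C ↔ Sum.inl j ∈ C := by simp [colPart]

@[simp] theorem rowPart_blockSet (A : Finset (Fin m)) (B : Finset (Fin n)) :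
    rowPart (blockSet A B) = A := by
  ext; simp [blockSet]

@[simp] theorem colPart_blockSet (A : Finset (Fin m)) (B : Finset (Fin n)) :
    colPart (blockSet A B) = B := by
  ext; simp [blockSet]

theorem blockSet_parts (C : Finset (Fin n ⊕ Fin m)) : blockSet (rowPart C) (colPart C) = C := by
  ext (j | i) <;> simp [blockSet]

theorem card_blockSet {A : Finset (Fin m)} {B : Finset (Fin n)} :
    (blockSet A B).card = m ↔ B.card = A.card := by
  have h := A.card_le_univ
  rw [Fintype.card_fin] at h
  rw [blockSet, Finset.card_disjSum, Finset.card_compl, Fintype.card_fin]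
  omega

/-- Thresholds up to `n` see only the columns of `X`. -/
theorem countBelow_blockRank_of_le (C : Finset (Fin n ⊕ Fin m)) {k : ℕ} (hk : k ≤ n) :
    countBelow blockRank C k = countBelow Fin.val (colPart C) k := by
  rw [countBelow, countBelow, ← Finset.card_map (Function.Embedding.inl : Fin n ↪ Fin n ⊕ Fin m)]
  congr 1
  ext (j | i)
  · simp
  · simp; omega

/-- The columns of `[X | 1]` of rank at least `n + (m - l)` are the unit vectors with index below
`l`, so a threshold beyond `n` counts the elements of `rowPart C` below `l`, up to a constant. -/
theorem countBelow_blockRank_add {C : Finset (Fin n ⊕ Fin m)} (hC : C.card = m) {l : ℕ}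
    (hl : l ≤ m) :
    countBelow blockRank C (n + (m - l)) + l = m + countBelow Fin.val (rowPart C) l := by
  have h1 : countBelow blockRank C (n + (m - l)) +
      (Finset.univ.filter fun i : Fin m => Sum.inr i ∈ C ∧ (i : ℕ) < l).card = m := by
    rw [countBelow, ← Finset.card_map (Function.Embedding.inr : Fin m ↪ Fin n ⊕ Fin m)]
    conv_rhs => rw [← hC]
    rw [← Finset.card_filter_add_card_filter_not (s := C) (fun x => blockRank x < n + (m - l))]
    congr 2
    ext (j | i)
    · simp; omega
    · simp; omega
  have h2 : (Finset.univ.filter fun i : Fin m => Sum.inr i ∈ C ∧ (i : ℕ) < l).card +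
      countBelow Fin.val (rowPart C) l = l := by
    have h3 : (Finset.univ.filter fun i : Fin m => (i : ℕ) < l).card = l := by
      simp [Fin.card_filter_val_lt, hl]
    conv_rhs => rw [← h3]
    rw [← Finset.card_filter_add_card_filter_not
      (s := Finset.univ.filter fun i : Fin m => (i : ℕ) < l) (fun i => Sum.inr i ∈ C), countBelow]
    congr 2
    · ext i; simp [and_comm]
    · ext i; simp [and_comm]
  omega

theorem countBelow_of_le {k l : ℕ} (S : Finset (Fin k)) (hl : k ≤ l) :
    countBelow Fin.val S l = S.card := by
  rw [countBelow, Finset.filter_true_of_mem fun x _ => x.2.trans_le hl]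

/-- The order on pairs of index sets is the order on sets of columns of `[X | 1]`. -/
theorem pairLE_iff_countBelow_blockRank_le {C D : Finset (Fin n ⊕ Fin m)} (hC : C.card = m)
    (hD : D.card = m) :
    PairLE (rowPart D, colPart D) (rowPart C, colPart C) ↔
      countBelow blockRank C ≤ countBelow blockRank D := by
  have hsmall : ∀ x : Fin n ⊕ Fin m, blockRank x < n + m := by
    rintro (j | i) <;> simp <;> omega
  rw [PairLE, indexLE_iff_countBelow_le, indexLE_iff_countBelow_le]
  constructor
  · rintro ⟨hr, hc⟩ k
    change countBelow blockRank C k ≤ countBelow blockRank D k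
    rcases le_total k n with hk | hk
    · rw [countBelow_blockRank_of_le _ hk, countBelow_blockRank_of_le _ hk]
      exact hc k
    · rcases le_total k (n + m) with hkm | hkm
      · have h1 := countBelow_blockRank_add hC (l := n + m - k) (by omega)
        have h2 := countBelow_blockRank_add hD (l := n + m - k) (by omega)
        have h3 : countBelow Fin.val (rowPart C) (n + m - k) ≤
            countBelow Fin.val (rowPart D) (n + m - k) := hr _
        rw [show n + (m - (n + m - k)) = k by omega] at h1 h2
        omega
      · rw [countBelow, countBelow, Finset.filter_true_of_mem fun x _ => (hsmall x).trans_le hkm,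
          Finset.filter_true_of_mem fun x _ => (hsmall x).trans_le hkm, hC, hD]
  · intro h
    constructor
    · have key (l : ℕ) (hl : l ≤ m) :
          countBelow Fin.val (rowPart C) l ≤ countBelow Fin.val (rowPart D) l := by
        have h1 := countBelow_blockRank_add hC hl
        have h2 := countBelow_blockRank_add hD hl
        have h3 : countBelow blockRank C (n + (m - l)) ≤
            countBelow blockRank D (n + (m - l)) := h _
        omega
      intro l
      rcases le_total l m with hl | hl
      · exact key l hl
      · have := key m le_rfl
        rwa [countBelow_of_le _ le_rfl, countBelow_of_le _ le_rfl, ← countBelow_of_le _ hl,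
          ← countBelow_of_le _ hl] at this
    · have key (l : ℕ) (hl : l ≤ n) :
          countBelow Fin.val (colPart C) l ≤ countBelow Fin.val (colPart D) l := by
        rw [← countBelow_blockRank_of_le _ hl, ← countBelow_blockRank_of_le _ hl]
        exact h l
      intro l
      rcases le_total l n with hl | hl
      · exact key l hl
      · have := key n le_rfl
        rwa [countBelow_of_le _ le_rfl, countBelow_of_le _ le_rfl, ← countBelow_of_le _ hl,
          ← countBelow_of_le _ hl] at this

/-- Up to sign, a maximal minor of `[X | 1]` is a minor of `X`. -/
theorem det_blockCol_eq_minor {R : Type*} [CommRing R] (X : Matrix (Fin m) (Fin n) R)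
    {d : Fin m → Fin n ⊕ Fin m} (hd : Function.Injective d) :
    ∃ ε : ℤˣ, det (of fun μ => blockCol X (d μ)) =
      (ε : ℤ) * minor X (rowPart (Finset.univ.image d)) (colPart (Finset.univ.image d)) := by
  set C := Finset.univ.image d with hC
  have hCm : C.card = m := by
    rw [hC, Finset.card_image_of_injective _ hd, Finset.card_univ, Fintype.card_fin]
  have hAB : (colPart C).card = (rowPart C).card := by
    rw [← card_blockSet, blockSet_parts, hCm]
  set A := rowPart C with hA
  set B := colPart C with hB
  let a := A.orderEmbOfFin rfl
  let b := B.orderEmbOfFin hAB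
  have hcard : Fintype.card (Fin A.card ⊕ {i // i ∉ A}) = Fintype.card (Fin m) := by
    have h := A.card_le_univ
    rw [Fintype.card_fin] at h
    rw [Fintype.card_sum, Fintype.card_subtype_compl]
    simp
    omega
  let e : Fin A.card ⊕ {i // i ∉ A} ≃ Fin m := Equiv.ofBijective (Sum.elim a Subtype.val) <| by
    rw [Fintype.bijective_iff_injective_and_card]
    refine ⟨a.injective.sumElim Subtype.val_injective fun ν i h => ?_, hcard⟩
    exact i.2 (h ▸ A.orderEmbOfFin_mem rfl ν)
  have hlift (x : Fin A.card ⊕ {i // i ∉ A}) : ∃ μ, d μ = Sum.map b Subtype.val x := by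
    rcases x with ν | i
    · have h : b ν ∈ B := B.orderEmbOfFin_mem hAB ν
      simpa [hB, hC] using h
    · simpa [hA, hC] using i.2
  choose g hg using hlift
  -- Reordered by `f` and `e`, the matrix has the minor in one corner and an identity matrix in the
  -- opposite one.
  let f : Fin A.card ⊕ {i // i ∉ A} ≃ Fin m := Equiv.ofBijective g <| by
    rw [Fintype.bijective_iff_injective_and_card]
    refine ⟨fun x y h => ?_, hcard⟩
    exact b.injective.sumMap Subtype.val_injective (by rw [← hg, ← hg, h])
  set M := of fun μ => blockCol X (d μ) with hM
  have hblock : M.submatrix f e =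
      fromBlocks (X.submatrix a b)ᵀ (of fun ν i => X i.1 (b ν)) 0 1 := by
    ext (ν | i) (ν' | i')
    · simp [hM, f, e, hg, blockCol]
    · simp [hM, f, e, hg, blockCol]
    · have : a ν' ≠ i.1 := fun h => i.2 (h ▸ A.orderEmbOfFin_mem rfl ν')
      simp [hM, f, e, hg, blockCol, this]
    · simp [hM, f, e, hg, blockCol, Pi.single_apply, one_apply, Subtype.ext_iff, eq_comm]
  have hdet : (M.submatrix f e).det = minor X A B := by
    rw [hblock, det_fromBlocks_zero₂₁, det_one, mul_one, det_transpose, minor, dif_pos hAB]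
  have hre := det_reindex f.symm e.symm M
  rw [reindex_apply, symm_symm, symm_symm, hdet] at hre
  refine ⟨Perm.sign (e.symm.trans f), ?_⟩
  rw [hre, ← mul_assoc]
  rw [← Int.cast_mul, ← Units.val_mul, Int.units_mul_self, Units.val_one, Int.cast_one, one_mul]

end Encoding

/-! ### Straightening products of maximal minors -/

section Straightening

variable {m n : ℕ} {R : Type*} [CommRing R]

theorem exists_enumeration {K : Type*} [DecidableEq K] (C : Finset K) (hC : C.card = m) :
    ∃ c : Fin m → K, Function.Injective c ∧ Finset.univ.image c = C := by
  refine ⟨fun i => ((C.equivFinOfCardEq hC).symm i).1,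
    Subtype.val_injective.comp (Equiv.injective _), ?_⟩
  ext x
  simp only [Finset.mem_image, Finset.mem_univ, true_and]
  constructor
  · rintro ⟨i, rfl⟩
    exact Subtype.prop _
  · intro hx
    exact ⟨C.equivFinOfCardEq hC ⟨x, hx⟩, by simp⟩

theorem card_subtype_eq_countBelow {K : Type*} [DecidableEq K] (r : K → ℕ) {c : Fin m → K}
    (hc : Function.Injective c) (k : ℕ) :
    Fintype.card {i // r (c i) < k} = countBelow r (Finset.univ.image c) k := by
  rw [Fintype.card_subtype, countBelow, Finset.filter_image, Finset.card_image_of_injective _ hc]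

/-- Replacing some elements of `C` of rank at least `k` by elements of rank below `k`, and permuting
the others, makes the set strictly smaller in the order on sets of columns. -/
theorem countBelow_lt_of_exchange {K : Type*} [DecidableEq K] (r : K → ℕ) {k : ℕ}
    {c d : Fin m → K} (hc : Function.Injective c) (hd : Function.Injective d)
    (hfix : ∀ i, r (c i) < k → d i = c i)
    (hnew : ∀ i, ¬ r (c i) < k → r (d i) < k ∨ ∃ j, d i = c j)
    (hex : ∃ i, ¬ r (c i) < k ∧ r (d i) < k) :
    countBelow r (Finset.univ.image c) < countBelow r (Finset.univ.image d) := by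
  set C := Finset.univ.image c with hC
  set D := Finset.univ.image d with hD
  have hcard : C.card = D.card := by
    rw [hC, hD, Finset.card_image_of_injective _ hc, Finset.card_image_of_injective _ hd]
  rw [Pi.lt_def]
  constructor
  · intro j
    change countBelow r C j ≤ countBelow r D j
    rcases le_or_gt j k with hj | hj
    · refine Finset.card_le_card fun x hx => ?_
      obtain ⟨hxC, hxj⟩ := Finset.mem_filter.mp hx
      obtain ⟨i, -, rfl⟩ := Finset.mem_image.mp hxC
      rw [Finset.mem_filter, ← hfix i (hxj.trans_le hj)]
      rw [← hfix i (hxj.trans_le hj)] at hxj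
      exact ⟨Finset.mem_image_of_mem _ (Finset.mem_univ _), hxj⟩
    · -- Above `k` the set `D` has only elements of `C`, so one compares complements.
      have h1 := Finset.card_filter_add_card_filter_not (s := C) (fun x => r x < j)
      have h2 := Finset.card_filter_add_card_filter_not (s := D) (fun x => r x < j)
      have h3 : (D.filter fun x => ¬ r x < j).card ≤ (C.filter fun x => ¬ r x < j).card := by
        refine Finset.card_le_card fun x hx => ?_
        obtain ⟨hxD, hxj⟩ := Finset.mem_filter.mp hx
        obtain ⟨i, -, rfl⟩ := Finset.mem_image.mp hxD
        refine Finset.mem_filter.mpr ⟨?_, hxj⟩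
        by_cases hi : r (c i) < k
        · rw [hfix i hi]
          exact Finset.mem_image_of_mem _ (Finset.mem_univ _)
        · obtain h | ⟨l, h⟩ := hnew i hi
          · omega
          · rw [h]
            exact Finset.mem_image_of_mem _ (Finset.mem_univ _)
      rw [countBelow, countBelow]
      omega
  · refine ⟨k, Finset.card_lt_card ?_⟩
    obtain ⟨i, hi, hdi⟩ := hex
    rw [Finset.ssubset_iff_of_subset]
    · refine ⟨d i, Finset.mem_filter.mpr
        ⟨Finset.mem_image_of_mem _ (Finset.mem_univ _), hdi⟩, fun h => ?_⟩
      obtain ⟨l, -, hl⟩ := Finset.mem_image.mp (Finset.mem_filter.mp h).1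
      have hlk : r (c l) < k := hl ▸ hdi
      obtain rfl : l = i := hd ((hfix l hlk).trans hl)
      exact hi hlk
    · intro x hx
      obtain ⟨hxC, hxk⟩ := Finset.mem_filter.mp hx
      obtain ⟨l, -, rfl⟩ := Finset.mem_image.mp hxC
      exact Finset.mem_filter.mpr
        ⟨hfix l hxk ▸ Finset.mem_image_of_mem d (Finset.mem_univ _), hxk⟩

/-- The minor of `X` that corresponds to a set of columns of `[X | 1]`. -/
def blockMinor (X : Matrix (Fin m) (Fin n) R) (C : Finset (Fin n ⊕ Fin m)) : R :=
  minor X (rowPart C) (colPart C)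

/-- One exchange step: a product that violates the order is an integral combination of products
with smaller first factor. -/
theorem blockMinor_mul_mem_closure_lt (X : Matrix (Fin m) (Fin n) R)
    {C C' : Finset (Fin n ⊕ Fin m)} (hC : C.card = m) (hC' : C'.card = m)
    (h : ¬ countBelow blockRank C' ≤ countBelow blockRank C) :
    blockMinor X C * blockMinor X C' ∈ AddSubgroup.closure {x : R | ∃ D D',
      D.card = m ∧ D'.card = m ∧ countBelow blockRank C < countBelow blockRank D ∧
      x = blockMinor X D * blockMinor X D'} := by
  obtain ⟨c, hc, rfl⟩ := exists_enumeration C hC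
  obtain ⟨c', hc', rfl⟩ := exists_enumeration C' hC'
  obtain ⟨k, hk⟩ := not_forall.mp h
  have hex := det_mul_det_mem_closure_exchange (blockCol X) c c' (fun x => blockRank x < k) (by
    rw [card_subtype_eq_countBelow _ hc, card_subtype_eq_countBelow _ hc']
    exact not_le.mp hk)
  have hunit (d d' : Fin m → Fin n ⊕ Fin m) (hd : Function.Injective d)
      (hd' : Function.Injective d') : ∃ ε : ℤˣ,
        det (of fun i => blockCol X (d i)) * det (of fun i => blockCol X (d' i)) =
        (ε : ℤ) • (blockMinor X (Finset.univ.image d) * blockMinor X (Finset.univ.image d')) := by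
    obtain ⟨ε, hε⟩ := det_blockCol_eq_minor X hd
    obtain ⟨ε', hε'⟩ := det_blockCol_eq_minor X hd'
    refine ⟨ε * ε', ?_⟩
    rw [hε, hε', zsmul_eq_mul, blockMinor, blockMinor]
    push_cast
    ring
  obtain ⟨ε, hε⟩ := hunit c c' hc hc'
  have hback := zsmul_mem hex (ε : ℤ)
  rw [hε, smul_smul, ← Units.val_mul, Int.units_mul_self, Units.val_one, one_smul] at hback
  refine (AddSubgroup.closure_le _).mpr ?_ hback
  rintro _ ⟨d, d', hfix, hnew, hlow, rfl⟩
  rw [SetLike.mem_coe]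
  by_cases hd : Function.Injective d
  · by_cases hd' : Function.Injective d'
    · obtain ⟨δ, hδ⟩ := hunit d d' hd hd'
      rw [hδ]
      refine zsmul_mem ?_ _
      refine AddSubgroup.subset_closure ⟨_, _, ?_, ?_,
        countBelow_lt_of_exchange blockRank hc hd hfix hnew hlow, rfl⟩ <;>
      simp [Finset.card_image_of_injective, hd, hd']
    · obtain ⟨i, j, hij, hne⟩ := Function.not_injective_iff.mp hd'
      rw [det_zero_of_row_eq (M := of fun i => blockCol X (d' i)) hne
        (congrArg (blockCol X) hij), mul_zero]
      exact zero_mem _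
  · obtain ⟨i, j, hij, hne⟩ := Function.not_injective_iff.mp hd
    rw [det_zero_of_row_eq (M := of fun i => blockCol X (d i)) hne
      (congrArg (blockCol X) hij), zero_mul]
    exact zero_mem _

/-- The straightening law for maximal minors of `[X | 1]`. -/
theorem blockMinor_mul_mem_closure_standard (X : Matrix (Fin m) (Fin n) R)
    (C C' : Finset (Fin n ⊕ Fin m)) (hC : C.card = m) (hC' : C'.card = m)
    (h : ¬ countBelow blockRank C' ≤ countBelow blockRank C) :
    blockMinor X C * blockMinor X C' ∈ AddSubgroup.closure {x : R | ∃ D D',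
      D.card = m ∧ D'.card = m ∧ countBelow blockRank C < countBelow blockRank D ∧
      countBelow blockRank D' ≤ countBelow blockRank D ∧
      x = blockMinor X D * blockMinor X D'} := by
  let rel (D C : Finset (Fin n ⊕ Fin m)) : Prop :=
    countBelow blockRank C < countBelow blockRank D
  have : IsTrans _ rel := ⟨fun _ _ _ h₁ h₂ => lt_trans h₂ h₁⟩
  have : Std.Irrefl rel := ⟨fun _ => lt_irrefl _⟩
  induction C using (Finite.wellFounded_of_trans_of_irrefl rel).induction generalizing C' with
  | _ C ih =>
  refine (AddSubgroup.closure_le _).mpr ?_ (blockMinor_mul_mem_closure_lt X hC hC' h)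
  rintro _ ⟨D, D', hD, hD', hlt, rfl⟩
  by_cases hstd : countBelow blockRank D' ≤ countBelow blockRank D
  · exact AddSubgroup.subset_closure ⟨D, D', hD, hD', hlt, hstd, rfl⟩
  · refine AddSubgroup.closure_mono ?_ (ih D hlt D' hD hD' hstd)
    rintro _ ⟨E, E', hE, hE', hlt', hstd', rfl⟩
    exact ⟨E, E', hE, hE', hlt.trans hlt', hstd', rfl⟩

/-! ### Specialization from the generic matrix -/

theorem map_minor {S : Type*} [CommRing S] (f : R →+* S) (X : Matrix (Fin m) (Fin n) R)
    (A : Finset (Fin m)) (B : Finset (Fin n)) : f (minor X A B) = minor (X.map f) A B := by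
  unfold minor
  split_ifs
  · rw [RingHom.map_det, RingHom.mapMatrix_apply, submatrix_map]
  · exact map_zero f

end Straightening

theorem AddSubgroup.exists_sum_units_of_mem_closure {M : Type*} [AddCommGroup M] {s : Set M}
    {x : M} (hx : x ∈ AddSubgroup.closure s) :
    ∃ (N : ℕ) (ε : Fin N → ℤˣ) (y : Fin N → M), (∀ i, y i ∈ s) ∧
      x = ∑ i, (ε i : ℤ) • y i := by
  rw [← AddSubgroup.mem_toAddSubmonoid, AddSubgroup.closure_toAddSubmonoid] at hx
  obtain ⟨l, hl, rfl⟩ := AddSubmonoid.exists_list_of_mem_closure hx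
  have h (i : Fin l.length) : ∃ (ε : ℤˣ) (y : M), y ∈ s ∧ l.get i = (ε : ℤ) • y := by
    obtain h | h := hl _ (l.get_mem i)
    · exact ⟨1, _, h, by simp⟩
    · exact ⟨-1, _, Set.mem_neg.mp h, by simp⟩
  choose ε y hy hε using h
  refine ⟨l.length, ε, y, hy, ?_⟩
  simp only [← hε, List.get_eq_getElem, Fin.sum_univ_getElem]

theorem theorem3 (m n : ℕ) (S' S'' : Finset (Fin m)) (T' T'' : Finset (Fin n))
    (h : ¬ PairLE (S', T') (S'', T'')) :
    ∃ (N : ℕ) (ε : Fin N → ℤˣ)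
      (U' U'' : Fin N → Finset (Fin m)) (V' V'' : Fin N → Finset (Fin n)),
      (∀ i, PairLT (U' i, V' i) (S', T') ∧ PairLE (U' i, V' i) (U'' i, V'' i)) ∧
      ∀ (R : Type*) [CommRing R] (X : Matrix (Fin m) (Fin n) R),
        minor X S' T' * minor X S'' T'' =
          ∑ i, ((ε i : ℤ) : R) * (minor X (U' i) (V' i) * minor X (U'' i) (V'' i)) := by
  -- A minor with different numbers of rows and columns is zero, and the empty sum will do.
  by_cases h' : T'.card = S'.card
  swap
  · exact ⟨0, finZeroElim, finZeroElim, finZeroElim, finZeroElim, finZeroElim,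
      fun i => i.elim0, fun R _ X => by simp [minor, h']⟩
  by_cases h'' : T''.card = S''.card
  swap
  · exact ⟨0, finZeroElim, finZeroElim, finZeroElim, finZeroElim, finZeroElim,
      fun i => i.elim0, fun R _ X => by simp [minor, h'']⟩
  have hC := card_blockSet.mpr h'
  have hC' := card_blockSet.mpr h''
  have hns : ¬ countBelow blockRank (blockSet S'' T'') ≤ countBelow blockRank (blockSet S' T') := by
    rw [← pairLE_iff_countBelow_blockRank_le hC' hC]
    simpa using h
  obtain ⟨N, ε, y, hy, hsum⟩ := AddSubgroup.exists_sum_units_of_mem_closure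
    (blockMinor_mul_mem_closure_standard (mvPolynomialX (Fin m) (Fin n) ℤ) _ _ hC hC' hns)
  choose D D' hD hD' hlt hle hDy using hy
  refine ⟨N, ε, fun i => rowPart (D i), fun i => rowPart (D' i), fun i => colPart (D i),
    fun i => colPart (D' i), fun i => ⟨⟨?_, fun he => ?_⟩, ?_⟩, fun R _ X => ?_⟩
  · have := (pairLE_iff_countBelow_blockRank_le hC (hD i)).mpr (hlt i).le
    simpa using this
  · have : D i = blockSet S' T' := by
      rw [← blockSet_parts (D i)]
      exact congrArg (fun p => blockSet p.1 p.2) he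
    exact (hlt i).ne (by rw [this])
  · exact (pairLE_iff_countBelow_blockRank_le (hD' i) (hD i)).mpr (hle i)
  · let φ : MvPolynomial (Fin m × Fin n) ℤ →+* R :=
      MvPolynomial.eval₂Hom (Int.castRingHom R) fun p => X p.1 p.2
    have hφ : (mvPolynomialX (Fin m) (Fin n) ℤ).map φ = X :=
      mvPolynomialX_map_eval₂ (Int.castRingHom R) X
    have := congrArg φ hsum
    simpa only [hDy, blockMinor, rowPart_blockSet, colPart_blockSet, map_mul, map_minor, hφ,
      map_sum, zsmul_eq_mul, map_intCast] using this
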